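/- Fix a finitary type $\Omega$ of operation symbols (constants allowed). A variety is the class of all $\Omega$-algebras satisfying some set of identities. An identity $t\approx u$ is linear if every variable occurs at most once in $t$ and at most once in $u$; a variety is linear if it can be defined by a set of linear identities. The linearization $\mathcal V^*$ of a variety $\mathcal V$ is the variety defined by all linear identities satisfied in $\mathcal V$. For an algebra $A$ let $\mathcal P^{<\omega}_{>0}A$ be its power algebra: the set of all non-empty finite subsets of $A$ with the operations $\omega(A_1,\dots,A_n)=\{\omega(a_1,\dots,a_n)\mid a_i\in A_i\}$; together with the union $\cup$ it is the extended power algebra of $A$. Let $\mathcal S_{\mathcal V}$ be the class of all semilattice ordered $\mathcal V$-algebras, that is, algebras $(B,\Omega,+)$ such that $(B,\Omega)\in\mathcal V$, $(B,+)$ is a semilattice, and every operation in $\Omega$ of positive arity distributes over $+$ in each argument. Let $F_{\mathcal V}(X)$ be the free algebra over a set $X$ in $\mathcal V$. Let $\mathcal V$ be a variety. Then: 1. $\mathcal V$ is linear if and only if $\mathcal V$ is closed under the power construction, i.e. $A\in\mathcal V$ implies $\mathcal P^{<\omega}_{>0}A\in\mathcal V$. 2. $\mathcal V$ is linear if and only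 if $\mathcal V=\mathcal V^*$. 3. For every infinite set $X$, $\mathcal V$ is linear if and only if $\mathcal P^{<\omega}_{>0}F_{\mathcal V}(X)\in\mathcal V$. 4. For every infinite set $X$, the extended power algebra $(\mathcal P^{<\omega}_{>0}F_{\mathcal V}(X),\Omega,\cup)$ is free over $X$ in $\mathcal S_{\mathcal V}$, with free generators $\{x\}$ for $x\in X$, if and only if $\mathcal V=\mathcal V^*$. 5. If $\mathcal V$ is linear then for every set $X$, finite or infinite, $\mathcal P^{<\omega}_{>0}F_{\mathcal V}(X)\in\mathcal V$ and $(\mathcal P^{<\omega}_{>0}F_{\mathcal V}(X),\Omega,\cup)$ is free over $X$ in $\mathcal S_{\mathcal V}$, with free generators $\{x\}$ for $x\in X$. -/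

import Mathlib

open scoped FirstOrder

universe u u' v w

namespace PowerAlgebra

/-! An algebra `(A, Ω)` of a finitary type is an `L.Structure` on `A`, where `L` is a language
with function symbols of finite arities (constants allowed) and no relation symbols. -/

section Identities

variable {L : FirstOrder.Language.{u, u'}}

/-- The number of occurrences of the variable `x` in a term. -/
def occurrences (x : ℕ) : L.Term ℕ → ℕ
  | .var y => if y = x then 1 else 0
  | .func _ ts => ∑ i, occurrences x (ts i)

/-- An identity `p.1 ≈ p.2` in the variables `x₀, x₁, x₂, …`. -/
abbrev Identity (L : FirstOrder.Language.{u, u'}) := L.Term ℕ × L.Term ℕ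

/-- The identity holds in the algebra `A`. -/
def Satisfies (A : Type w) [L.Structure A] (p : Identity L) : Prop :=
  ∀ ρ : ℕ → A, p.1.realize ρ = p.2.realize ρ

/-- Every variable occurs at most once on each side. -/
def Identity.IsLinear (p : Identity L) : Prop :=
  ∀ x : ℕ, occurrences x p.1 ≤ 1 ∧ occurrences x p.2 ≤ 1

end Identities

/-- A variety: a class of algebras that is defined by a set of identities. -/
structure Variety (L : FirstOrder.Language.{u, u'}) where
  Mem : (A : Type w) → [L.Structure A] → Prop
  equational : ∃ E : Set (Identity L),
    ∀ (A : Type w) [L.Structure A], Mem A ↔ ∀ p ∈ E, Satisfies A p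

namespace Variety

variable {L : FirstOrder.Language.{u, u'}} (V : Variety.{u, u', w} L)

/-- The variety is defined by some set of linear identities. -/
def IsLinear : Prop :=
  ∃ E : Set (Identity L), (∀ p ∈ E, p.IsLinear) ∧
    ∀ (A : Type w) [L.Structure A], V.Mem A ↔ ∀ p ∈ E, Satisfies A p

/-- The linear identities that are true in all members of the variety. -/
def linearIdentities : Set (Identity L) :=
  {p | p.IsLinear ∧ ∀ (A : Type w) [L.Structure A], V.Mem A → Satisfies A p}

/-- The linearization `V*`: the variety defined by all linear identities satisfied in `V`. -/
def linearization : Variety.{u, u', w} L where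
  Mem A _ := ∀ p ∈ V.linearIdentities, Satisfies A p
  equational := ⟨V.linearIdentities, fun _ _ => Iff.rfl⟩

end Variety

section Power

/-- The set of nonempty finite subsets of `A`. -/
def FinPow (A : Type w) : Type w := {S : Set A // S.Nonempty ∧ S.Finite}

/-- Nonempty finite subsets with set-theoretical union as join. -/
instance (A : Type w) : SemilatticeSup (FinPow A) :=
  Subtype.semilatticeSup fun _ _ hS hT => ⟨hS.1.mono Set.subset_union_left, hS.2.union hT.2⟩

/-- The singleton of `a`. -/
def FinPow.single {A : Type w} (a : A) : FinPow A :=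
  ⟨{a}, Set.singleton_nonempty a, Set.finite_singleton a⟩

/-- The power algebra of nonempty finite subsets, with the complex operations
`ω(S₁, …, Sₙ) = {ω(a₁, …, aₙ) | aᵢ ∈ Sᵢ}`. -/
instance (L : FirstOrder.Language.{u, u'}) [L.IsAlgebraic] (A : Type w) [L.Structure A] :
    L.Structure (FinPow A) where
  funMap ω S := ⟨{b | ∃ a : Fin _ → A, (∀ i, a i ∈ (S i).1) ∧ FirstOrder.Language.Structure.funMap ω a = b},
    ⟨_, fun i => (S i).2.1.some, fun i => (S i).2.1.some_mem, rfl⟩,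
    by
      have h : {a : Fin _ → A | ∀ i, a i ∈ (S i).1}.Finite := Set.Finite.pi' fun i => (S i).2.2
      exact (h.image (FirstOrder.Language.Structure.funMap ω)).subset
        fun b ⟨a, ha, hb⟩ => ⟨a, ha, hb⟩⟩
  RelMap r := isEmptyElim r

/-- The variety contains with each algebra `A` its power algebra of nonempty finite subsets. -/
def Variety.ClosedUnderPower {L : FirstOrder.Language.{u, u'}} [L.IsAlgebraic]
    (V : Variety.{u, u', w} L) : Prop :=
  ∀ (A : Type w) [L.Structure A], V.Mem A → V.Mem (FinPow A)

end Power

namespace Variety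

variable {L : FirstOrder.Language.{u, u'}} (V : Variety.{u, u', w} L) (X : Type v)

/-- Two terms over `X` are identified if they have the same value in every member of `V` under
every assignment of the variables. -/
def termSetoid : Setoid (L.Term X) where
  r s t := ∀ (A : Type w) [L.Structure A], V.Mem A → ∀ ρ : X → A, s.realize ρ = t.realize ρ
  iseqv :=
    { refl := fun _ _ _ _ _ => rfl
      symm := fun h A _ hA ρ => (h A hA ρ).symm
      trans := fun h k A _ hA ρ => (h A hA ρ).trans (k A hA ρ) }

/-- The free algebra `F_V(X)` over `X` in `V`: the term algebra over `X` modulo the identities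
of `V`. -/
def FreeAlg : Type (max u v) := Quotient (V.termSetoid X)

variable {X} in
/-- The class of a term in `F_V(X)`. -/
def FreeAlg.mk (t : L.Term X) : V.FreeAlg X := Quotient.mk (V.termSetoid X) t

variable {X} in
/-- The free generator of `F_V(X)` given by `x`. -/
def FreeAlg.of (x : X) : V.FreeAlg X := FreeAlg.mk V (.var x)

/-- The term algebra, with operations that respect the identities of `V`. -/
@[reducible]
def termPrestructure [L.IsAlgebraic] : L.Prestructure (V.termSetoid X) where
  toStructure := { funMap := fun ω ts => .func ω ts, RelMap := fun r => isEmptyElim r }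
  fun_equiv := by
    intro n ω s t h A _ hA ρ
    exact congrArg (FirstOrder.Language.Structure.funMap ω) (funext fun i => h i A hA ρ)
  rel_equiv := fun {_ r} => isEmptyElim r

instance [L.IsAlgebraic] : L.Structure (V.FreeAlg X) :=
  letI := V.termPrestructure X
  inferInstanceAs (L.Structure (Quotient (V.termSetoid X)))

end Variety

section SemilatticeOrdered

variable {L : FirstOrder.Language.{u, u'}} (V : Variety.{u, u', w} L)

/-- `B` is a semilattice ordered `V`-algebra: its `Ω`-reduct lies in `V` and the operations
distribute over the join in each argument. -/
def Variety.MemS (B : Type w) [L.Structure B] [SemilatticeSup B] : Prop :=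
  V.Mem B ∧ ∀ (n : ℕ) (ω : L.Functions n) (x : Fin n → B) (i : Fin n) (a b : B),
    FirstOrder.Language.Structure.funMap ω (Function.update x i (a ⊔ b)) =
      FirstOrder.Language.Structure.funMap ω (Function.update x i a) ⊔
        FirstOrder.Language.Structure.funMap ω (Function.update x i b)

/-- `B` with the map `ι : X → B` is free over `X` in the variety `S_V` of all semilattice ordered
`V`-algebras. -/
def Variety.IsFreeInS {X : Type v} (B : Type w) [L.Structure B] [SemilatticeSup B]
    (ι : X → B) : Prop :=
  V.MemS B ∧ ∀ (C : Type w) [L.Structure C] [SemilatticeSup C], V.MemS C → ∀ g : X → C,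
    ∃! h : B →[L] C, (∀ a b : B, h (a ⊔ b) = h a ⊔ h b) ∧ ∀ x : X, h (ι x) = g x

end SemilatticeOrdered

end PowerAlgebra

/-! A term without repeated variables is evaluated elementwise on sets (`mem_realize_finPow_iff`),
so linear identities pass from `A` to its power algebra. Conversely, let `s ≈ t` hold in `V`, with
the power algebra of the free algebra over an infinite set in `V`. Rename the occurrences in `s`
apart to get `s'`, and send each variable to the set of generators naming its occurrences. The class
of `s'` lies in the value of `s`, hence in that of `t`, so `V` satisfies `s' ≈ t'` for some `t'`
that collapses to `t` (`exists_linear_left`). A second pass from the other side makes both sides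
linear, and collapsing variables recovers `s ≈ t`. For freeness, a map on generators extends to the
free algebra and then to finite sets by taking joins of values. -/

namespace PowerAlgebra

open FirstOrder FirstOrder.Language FirstOrder.Language.Structure

/-! ### Renaming occurrences apart -/

section Linearize

variable {L : FirstOrder.Language.{u, u'}}

/-- Rename the variables of a term so that each occurrence of a variable carries its own position
in the term, below the position `p`. -/
def linearize : List ℕ → L.Term ℕ → L.Term ℕ
  | p, .var x => .var (Nat.pair x (Encodable.encode p))
  | p, .func f ts => .func f fun i => linearize (i.1 :: p) (ts i)

/-- The variable of which `n` is a renamed occurrence. -/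
def origin (n : ℕ) : ℕ := n.unpair.1

theorem relabel_linearize (t : L.Term ℕ) :
    ∀ p : List ℕ, (linearize p t).relabel origin = t := by
  induction t with
  | var x => intro p; simp [linearize, Term.relabel, origin]
  | func f ts ih => intro p; simp [linearize, Term.relabel, ih]

/-- Positions list the innermost index first, so descending into a term extends them at the head.
This keeps the variables of different arguments disjoint. -/
theorem suffix_of_occurrences_linearize (t : L.Term ℕ) :
    ∀ (p q : List ℕ) (x : ℕ),
      occurrences (Nat.pair x (Encodable.encode q)) (linearize p t) ≠ 0 → p <:+ q := by
  induction t with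
  | var y =>
    intro p q x h
    have h' : Nat.pair y (Encodable.encode p) = Nat.pair x (Encodable.encode q) := by
      by_contra hne
      exact h (by simp [linearize, occurrences, hne])
    have := (Nat.pair_eq_pair.1 h').2
    rw [Encodable.encode_injective this]
  | func f ts ih =>
    intro p q x h
    simp only [linearize, occurrences] at h
    obtain ⟨i, -, hi⟩ := Finset.exists_ne_zero_of_sum_ne_zero h
    exact (List.suffix_cons _ _).trans (ih i _ _ _ hi)

theorem occurrences_linearize_le_one (t : L.Term ℕ) :
    ∀ (p : List ℕ) (n : ℕ), occurrences n (linearize p t) ≤ 1 := by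
  induction t with
  | var y => intro p n; simp only [linearize, occurrences]; split <;> simp
  | func f ts ih =>
    intro p n
    simp only [linearize, occurrences]
    by_cases h : ∃ i, occurrences n (linearize (i.1 :: p) (ts i)) ≠ 0
    · obtain ⟨i, hi⟩ := h
      rw [Finset.sum_eq_single i]
      · exact ih i _ _
      · intro j _ hji
        by_contra hj
        obtain ⟨q, hq⟩ : ∃ q : List ℕ, Encodable.encode q = n.unpair.2 :=
          ⟨Denumerable.ofNat (List ℕ) n.unpair.2, Denumerable.encode_ofNat _⟩
        rw [← Nat.pair_unpair n, ← hq] at hi hj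
        have hi' := suffix_of_occurrences_linearize _ _ _ _ hi
        have hj' := suffix_of_occurrences_linearize _ _ _ _ hj
        -- Two suffixes of `q` of equal length coincide.
        have := (List.suffix_of_suffix_length_le hj' hi' (by simp)).eq_of_length (by simp)
        exact hji (Fin.ext (List.cons.inj this).1)
      · simp
    · push Not at h
      simp [h]

/-- Renaming can merge variables but never split one, so linearity of the renamed term passes back
to `t`. -/
theorem occurrences_le_occurrences_relabel (σ : ℕ → ℕ) (n : ℕ) (t : L.Term ℕ) :
    occurrences n t ≤ occurrences (σ n) (t.relabel σ) := by
  induction t with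
  | var y =>
    simp only [Term.relabel, occurrences]
    split_ifs <;> simp_all
  | func f ts ih =>
    simp only [Term.relabel, occurrences]
    exact Finset.sum_le_sum fun i _ => ih i

theorem realize_congr_of_occurrences {A : Type w} [L.Structure A] (t : L.Term ℕ) {r r' : ℕ → A}
    (h : ∀ x, occurrences x t ≠ 0 → r x = r' x) : t.realize r = t.realize r' := by
  induction t with
  | var y => exact h y (by simp [occurrences])
  | func f ts ih =>
    simp only [Term.realize_func]
    congr 1
    funext i
    refine ih i fun x hx => h x fun h0 => hx ?_
    simp only [occurrences, Finset.sum_eq_zero_iff] at h0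
    exact h0 i (Finset.mem_univ i)

end Linearize

/-! ### Evaluation of terms in power algebras -/

section PowerRealize

variable {L : FirstOrder.Language.{u, u'}} [L.IsAlgebraic] {A : Type w} [L.Structure A]

theorem mem_funMap_finPow {n : ℕ} (ω : L.Functions n) (S : Fin n → FinPow A) (b : A) :
    b ∈ (funMap ω S).1 ↔ ∃ a : Fin n → A, (∀ i, a i ∈ (S i).1) ∧ funMap ω a = b :=
  Iff.rfl

theorem FinPow.mem_sup (S T : FinPow A) (a : A) : a ∈ (S ⊔ T).1 ↔ a ∈ S.1 ∨ a ∈ T.1 :=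
  Iff.rfl

theorem FinPow.mem_single (a b : A) : b ∈ (FinPow.single a).1 ↔ b = a :=
  Iff.rfl

theorem FinPow.ext {S T : FinPow A} (h : ∀ a, a ∈ S.1 ↔ a ∈ T.1) : S = T :=
  Subtype.ext (Set.ext h)

/-- This inclusion needs no linearity. The reverse can fail when a variable repeats, since its
occurrences may choose different elements. -/
theorem realize_mem_realize_finPow {α : Type*} (t : L.Term α) {ρ : α → FinPow A} {r : α → A}
    (h : ∀ x, r x ∈ (ρ x).1) : t.realize r ∈ (t.realize ρ).1 := by
  induction t with
  | var y => exact h y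
  | func f ts ih => exact ⟨_, ih, rfl⟩

/-- A term without repeated variables is evaluated elementwise in a power algebra. -/
theorem mem_realize_finPow_iff (t : L.Term ℕ) (ht : ∀ x, occurrences x t ≤ 1)
    (ρ : ℕ → FinPow A) (b : A) :
    b ∈ (t.realize ρ).1 ↔ ∃ r : ℕ → A, (∀ x, r x ∈ (ρ x).1) ∧ t.realize r = b := by
  classical
  refine ⟨fun hb => ?_, fun ⟨r, hr, hb⟩ => hb ▸ realize_mem_realize_finPow t hr⟩
  induction t generalizing b with
  | var y =>
    refine ⟨Function.update (fun x => (ρ x).2.1.some) y b, fun x => ?_, by simp⟩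
    by_cases hx : x = y
    · subst hx; simpa using hb
    · simpa [hx] using (ρ x).2.1.some_mem
  | func f ts ih =>
    obtain ⟨a, ha, rfl⟩ := hb
    simp only [occurrences] at ht
    have hle : ∀ i x, occurrences x (ts i) ≤ 1 := fun i x =>
      (Finset.single_le_sum (f := fun i => occurrences x (ts i)) (fun _ _ => Nat.zero_le _)
        (Finset.mem_univ i)).trans (ht x)
    choose r hr hra using fun i => ih i (hle i) (a i) (ha i)
    -- Each variable lies in at most one argument, so the assignments `r i` glue; elsewhere any
    -- element of `ρ x` will do.
    let R : ℕ → A := fun x =>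
      if h : ∃ i, occurrences x (ts i) ≠ 0 then r h.choose x else (ρ x).2.1.some
    refine ⟨R, fun x => ?_, ?_⟩
    · by_cases h : ∃ i, occurrences x (ts i) ≠ 0
      · simpa only [R, dif_pos h] using hr _ x
      · simpa only [R, dif_neg h] using (ρ x).2.1.some_mem
    · simp only [Term.realize_func]
      congr 1
      funext i
      rw [← hra i]
      refine realize_congr_of_occurrences _ fun x hx => ?_
      have h : ∃ i, occurrences x (ts i) ≠ 0 := ⟨i, hx⟩
      have hi : h.choose = i := by
        by_contra hne
        have hsum := Finset.add_le_sum (f := fun i => occurrences x (ts i))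
          (fun _ _ => Nat.zero_le _) (Finset.mem_univ h.choose) (Finset.mem_univ i) hne
        have h1 := h.choose_spec
        have h2 := ht x
        omega
      simp only [R, dif_pos h, hi]

theorem Satisfies.finPow {p : Identity L} (hp : p.IsLinear) (h : Satisfies A p) :
    Satisfies (FinPow A) p := by
  intro ρ
  refine FinPow.ext fun b => ?_
  rw [mem_realize_finPow_iff _ fun x => (hp x).1, mem_realize_finPow_iff _ fun x => (hp x).2]
  simp only [h _]

end PowerRealize

namespace Variety

variable {L : FirstOrder.Language.{u, u'}}

theorem ext_mem {V W : Variety.{u, u', w} L}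
    (h : ∀ (A : Type w) [L.Structure A], V.Mem A ↔ W.Mem A) : V = W := by
  cases V
  cases W
  congr
  funext A _
  exact propext (h A)

theorem isLinear_iff_eq_linearization (V : Variety.{u, u', w} L) :
    V.IsLinear ↔ V = V.linearization := by
  refine ⟨fun ⟨E, hE, hV⟩ => ext_mem fun A _ => ⟨fun hA p hp => hp.2 A hA, fun hA => ?_⟩, fun h =>
    ⟨V.linearIdentities, fun p hp => hp.1, fun A _ => ?_⟩⟩
  · exact (hV A).2 fun p hp => hA p ⟨hE p hp, fun B _ hB => (hV B).1 hB p hp⟩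
  · constructor
    · exact fun hA p hp => hp.2 A hA
    · intro hA
      rw [h]
      exact hA

/-! ### Power algebras of free algebras and linearity -/

section Free

variable (V : Variety.{u, u', max u v} L) {X : Type v}

theorem FreeAlg.mk_eq_mk {s t : L.Term X} : FreeAlg.mk V s = FreeAlg.mk V t ↔
    ∀ (A : Type (max u v)) [L.Structure A], V.Mem A → ∀ ρ : X → A,
      s.realize ρ = t.realize ρ :=
  Quotient.eq (r := V.termSetoid X)

theorem FreeAlg.exists_mk (a : V.FreeAlg X) : ∃ t, FreeAlg.mk V t = a :=
  Quotient.exists_rep a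

variable [L.IsAlgebraic]

theorem FreeAlg.funMap_mk {n : ℕ} (f : L.Functions n) (ts : Fin n → L.Term X) :
    funMap f (fun i => FreeAlg.mk V (ts i)) = FreeAlg.mk V (.func f ts) :=
  letI := V.termPrestructure X
  funMap_quotient_mk' (s := V.termSetoid X) f ts

theorem FreeAlg.realize_mk {α : Type*} (t : L.Term α) (τ : α → L.Term X) :
    t.realize (fun x => FreeAlg.mk V (τ x)) = FreeAlg.mk V (t.subst τ) := by
  induction t with
  | var y => rfl
  | func f ts ih =>
    simp only [Term.realize_func, ih, Term.subst]
    exact FreeAlg.funMap_mk V f _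

theorem mem_freeAlg : V.Mem (V.FreeAlg X) := by
  obtain ⟨E, hE⟩ := V.equational
  refine (hE _).2 fun p hp ρ => ?_
  choose τ hτ using fun x => FreeAlg.exists_mk V (ρ x)
  obtain rfl : (fun x => FreeAlg.mk V (τ x)) = ρ := funext hτ
  rw [FreeAlg.realize_mk, FreeAlg.realize_mk, FreeAlg.mk_eq_mk]
  intro A _ hA r
  rw [Term.realize_subst, Term.realize_subst]
  exact (hE A).1 hA p hp _

theorem IsLinear.closedUnderPower {V : Variety.{u, u', w} L} (h : V.IsLinear) :
    V.ClosedUnderPower := by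
  obtain ⟨E, hE, hV⟩ := h
  exact fun A _ hA => (hV _).2 fun p hp => ((hV A).1 hA p hp).finPow (hE p hp)

/-- If the power algebra of the free algebra is in `V`, then an identity of `V` is obtained by
renaming variables in an identity of `V` whose left hand side has no repeated variables. -/
theorem exists_linear_left [Infinite X] (h : V.Mem (FinPow (V.FreeAlg X))) {s t : L.Term ℕ}
    (hst : ∀ (A : Type (max u v)) [L.Structure A], V.Mem A → Satisfies A (s, t)) :
    ∃ s' t' : L.Term ℕ, s'.relabel origin = s ∧ t'.relabel origin = t ∧
      (∀ x, occurrences x s' ≤ 1) ∧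
      ∀ (A : Type (max u v)) [L.Structure A], V.Mem A → Satisfies A (s', t') := by
  classical
  let e := Infinite.natEmbedding X
  let s' := linearize [] s
  have hs' : s'.relabel origin = s := relabel_linearize s []
  -- Variable `i` goes to the generators of its renamed occurrences in `s'`; `Nat.pair i 0` only
  -- keeps the set nonempty.
  let ρ : ℕ → FinPow (V.FreeAlg X) := fun i =>
    ⟨(fun m => FreeAlg.of V (e m)) '' {m | origin m = i ∧ (m ∈ s'.varFinset ∨ m = Nat.pair i 0)},
      ⟨_, Nat.pair i 0, by simp [origin], rfl⟩,
      (((s'.varFinset ∪ {Nat.pair i 0}).finite_toSet).subset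
        (by intro m hm; simpa [or_comm] using hm.2)).image _⟩
  have hmem : ∀ u : L.Term ℕ, u.varFinset ⊆ s'.varFinset →
      FreeAlg.mk V (u.relabel e) ∈ ((u.relabel origin).realize ρ).1 := by
    intro u
    induction u with
    | var y =>
      intro hu
      exact ⟨y, ⟨rfl, Or.inl (hu (by simp [Term.varFinset]))⟩, rfl⟩
    | func f ts ih =>
      intro hu
      refine ⟨_, fun i => ih i fun x hx => hu ?_, FreeAlg.funMap_mk V f _⟩
      simp only [Term.varFinset, Finset.mem_biUnion]
      exact ⟨i, Finset.mem_univ i, hx⟩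
  -- Choosing a generator separately at each occurrence turns `u` into a term that `origin`
  -- collapses back to `u`.
  have hinst : ∀ (u : L.Term ℕ) (b : V.FreeAlg X), b ∈ (u.realize ρ).1 →
      ∃ u' : L.Term ℕ, u'.relabel origin = u ∧ FreeAlg.mk V (u'.relabel e) = b := by
    intro u
    induction u with
    | var y =>
      rintro b ⟨m, hm, rfl⟩
      exact ⟨.var m, by simp [Term.relabel, hm.1], rfl⟩
    | func f ts ih =>
      rintro b ⟨a, ha, rfl⟩
      choose u' hu' hb using fun i => ih i (a i) (ha i)
      refine ⟨.func f u', by simp [Term.relabel, hu'], ?_⟩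
      rw [← funext hb, FreeAlg.funMap_mk]
      rfl
  have hs := hmem s' subset_rfl
  rw [hs', show s.realize ρ = t.realize ρ from hst _ h ρ] at hs
  obtain ⟨t', ht', heq⟩ := hinst t _ hs
  refine ⟨s', t', hs', ht', occurrences_linearize_le_one s [], fun A _ hA r => ?_⟩
  have : Nonempty A := ⟨r 0⟩
  -- Only generators in the range of `e` occur, so the default `r 0` is harmless.
  have key := (FreeAlg.mk_eq_mk V).1 heq A hA (Function.extend e r fun _ => r 0)
  simp only [Term.realize_relabel, Function.extend_comp e.injective] at key
  exact key.symm

theorem isLinear_of_mem_finPow_freeAlg [Infinite X] (h : V.Mem (FinPow (V.FreeAlg X))) :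
    V.IsLinear := by
  refine ⟨V.linearIdentities, fun p hp => hp.1, fun A _ => ⟨fun hA p hp => hp.2 A hA, fun hA => ?_⟩⟩
  obtain ⟨E, hE⟩ := V.equational
  refine (hE A).2 fun p hp ρ => ?_
  obtain ⟨s₁, t₁, hs₁, ht₁, hlin₁, h₁⟩ := V.exists_linear_left h (s := p.1) (t := p.2)
    fun B _ hB => (hE B).1 hB p hp
  obtain ⟨t₂, s₂, ht₂, hs₂, hlin₂, h₂⟩ := V.exists_linear_left h (s := t₁) (t := s₁)
    fun B _ hB r => (h₁ B hB r).symm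
  have hq : ((s₂, t₂) : Identity L) ∈ V.linearIdentities := by
    refine ⟨fun x => ⟨?_, hlin₂ x⟩, fun B _ hB r => (h₂ B hB r).symm⟩
    -- The second pass keeps the first side linear, because `s₂` collapses to the linear term `s₁`.
    refine (occurrences_le_occurrences_relabel origin x s₂).trans ?_
    rw [hs₂]
    exact hlin₁ _
  rw [← hs₁, ← ht₁, ← hs₂, ← ht₂]
  simp only [Term.realize_relabel]
  exact hA _ hq _

/-- Complex operations always distribute over union: the `i`-th argument of a value is drawn from
one set or the other. -/
theorem memS_finPow_iff {A : Type w} [L.Structure A] (V : Variety.{u, u', w} L) :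
    V.MemS (FinPow A) ↔ V.Mem (FinPow A) := by
  refine ⟨fun h => h.1, fun h => ⟨h, fun n ω x i S T => FinPow.ext fun b => ?_⟩⟩
  simp only [FinPow.mem_sup, mem_funMap_finPow]
  rw [← exists_or]
  refine exists_congr fun a => ?_
  rw [← or_and_right]
  refine and_congr_left fun _ => ?_
  have key : ∀ U : FinPow A, (∀ j, a j ∈ (Function.update x i U j).1) ↔
      a i ∈ U.1 ∧ ∀ j, j ≠ i → a j ∈ (x j).1 := fun U =>
    Function.forall_update_iff x fun j S => a j ∈ S.1
  rw [key, key, key, FinPow.mem_sup, or_and_right]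

end Free

/-! ### Joins over finite sets in semilattice ordered algebras -/

section Extension

variable {C : Type w} [L.Structure C] [SemilatticeSup C]

/-- Since `a ≤ b` means `a ⊔ b = b`, distributivity gives monotonicity in one argument; arguments
are raised one at a time. -/
theorem MemS.funMap_mono {V : Variety.{u, u', w} L} (hC : V.MemS C) {n : ℕ} (ω : L.Functions n)
    {x y : Fin n → C} (hxy : x ≤ y) : funMap ω x ≤ funMap ω y := by
  classical
  suffices H : ∀ s : Finset (Fin n), funMap ω x ≤ funMap ω (s.piecewise y x) by
    simpa using H Finset.univ
  intro s
  induction s using Finset.induction_on with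
  | empty => simp
  | insert i s hi ih =>
    refine ih.trans ?_
    rw [Finset.piecewise_insert]
    have h := hC.2 n ω (s.piecewise y x) i (x i) (y i)
    rw [sup_eq_right.2 (hxy i)] at h
    have hx : Function.update (s.piecewise y x) i (x i) = s.piecewise y x := by
      rw [Function.update_eq_self_iff]
      simp [hi]
    rw [hx] at h
    exact h ▸ le_sup_left

/-- In a semilattice ordered algebra the operations are compatible with joins of nonempty finite
families in all arguments at once. -/
theorem MemS.funMap_sup'_le {V : Variety.{u, u', w} L} (hC : V.MemS C) {n : ℕ}
    (ω : L.Functions n) {α : Type*} (T : Fin n → Finset α) (hT : ∀ i, (T i).Nonempty)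
    (g : α → C) (c : C)
    (hc : ∀ a : Fin n → α, (∀ i, a i ∈ T i) → funMap ω (fun i => g (a i)) ≤ c) :
    funMap ω (fun i => (T i).sup' (hT i) g) ≤ c := by
  classical
  -- Arguments in `s` are already full joins, the others still single values. Keeping `a` general
  -- lets each step vary one more coordinate.
  suffices H : ∀ s : Finset (Fin n), ∀ a : Fin n → α, (∀ i, a i ∈ T i) →
      funMap ω (s.piecewise (fun i => (T i).sup' (hT i) g) fun i => g (a i)) ≤ c by
    simpa using H Finset.univ (fun i => (hT i).choose) fun i => (hT i).choose_spec
  intro s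
  induction s using Finset.induction_on with
  | empty => simpa using hc
  | insert i s hi ih =>
    intro a ha
    rw [Finset.piecewise_insert]
    refine Finset.sup'_induction (hT i) g
      (p := fun z => funMap ω (Function.update (s.piecewise _ _) i z) ≤ c) ?_ ?_
    · intro z₁ h₁ z₂ h₂
      rw [hC.2]
      exact sup_le h₁ h₂
    · intro b hb
      convert ih (Function.update a i b) ?_ using 2
      · funext j
        by_cases hj : j = i
        · subst hj; simp [hi]
        · by_cases hjs : j ∈ s <;> simp [hj, hjs]
      · intro j
        by_cases hj : j = i
        · subst hj; simpa using hb
        · simpa [hj] using ha j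

/-- The join of the values of a map on a nonempty finite set. -/
noncomputable def finPowSup {A : Type w} (g : A → C) (S : FinPow A) : C :=
  S.2.2.toFinset.sup' (by simpa using S.2.1) g

theorem finPowSup_le_iff {A : Type w} (g : A → C) (S : FinPow A) (c : C) :
    finPowSup g S ≤ c ↔ ∀ a ∈ S.1, g a ≤ c := by
  simp [finPowSup, Finset.sup'_le_iff]

theorem le_finPowSup {A : Type w} (g : A → C) (S : FinPow A) {a : A} (ha : a ∈ S.1) :
    g a ≤ finPowSup g S :=
  (finPowSup_le_iff g S _).1 le_rfl a ha

theorem finPowSup_single {A : Type w} (g : A → C) (a : A) :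
    finPowSup g (FinPow.single a) = g a := by
  refine le_antisymm ((finPowSup_le_iff _ _ _).2 ?_) (le_finPowSup _ _ rfl)
  rintro b rfl
  exact le_rfl

theorem finPowSup_sup {A : Type w} (g : A → C) (S T : FinPow A) :
    finPowSup g (S ⊔ T) = finPowSup g S ⊔ finPowSup g T := by
  refine eq_of_forall_ge_iff fun c => ?_
  simp only [sup_le_iff, finPowSup_le_iff]
  exact ⟨fun h => ⟨fun a ha => h a (Or.inl ha), fun a ha => h a (Or.inr ha)⟩,
    fun h a ha => ha.elim (h.1 a) (h.2 a)⟩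

/-- One inequality is monotonicity, the other distributivity in all arguments at once. -/
theorem MemS.finPowSup_funMap [L.IsAlgebraic] {V : Variety.{u, u', w} L} (hC : V.MemS C)
    {A : Type w} [L.Structure A] (g : A →[L] C) {n : ℕ} (ω : L.Functions n)
    (S : Fin n → FinPow A) :
    finPowSup g (funMap ω S) = funMap ω fun i => finPowSup g (S i) := by
  apply le_antisymm
  · rw [finPowSup_le_iff]
    rintro b ⟨a, ha, rfl⟩
    rw [g.map_fun]
    exact hC.funMap_mono ω fun i => le_finPowSup g (S i) (ha i)
  · refine hC.funMap_sup'_le ω _ _ _ _ fun a ha => ?_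
    rw [← Function.comp_def, ← g.map_fun]
    exact le_finPowSup g _ ⟨a, fun i => by simpa using ha i, rfl⟩

theorem FinPow.induction_sup {A : Type w} {P : FinPow A → Prop}
    (single : ∀ a, P (FinPow.single a)) (sup : ∀ S T, P S → P T → P (S ⊔ T)) (S : FinPow A) :
    P S := by
  obtain ⟨S, hne, hfin⟩ := S
  induction S, hfin using Set.Finite.induction_on with
  | empty => exact absurd hne Set.not_nonempty_empty
  | @insert a s _ hs ih =>
    rcases s.eq_empty_or_nonempty with rfl | hs'
    · have h : (⟨insert a ∅, hne, Set.toFinite _⟩ : FinPow A) = FinPow.single a :=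
        Subtype.ext (insert_empty_eq a)
      exact h ▸ single a
    · exact sup _ _ (single a) (ih hs')

end Extension

/-! ### The universal property -/

section Universal

variable [L.IsAlgebraic] (V : Variety.{u, u', max u v} L) {X : Type v}

/-- The homomorphism from the free algebra to a member of `V` that extends a map on the
generators. -/
def FreeAlg.lift {C : Type (max u v)} [L.Structure C] (hC : V.Mem C) (g : X → C) :
    V.FreeAlg X →[L] C where
  toFun := Quotient.lift (fun t : L.Term X => t.realize g) fun _ _ h => h C hC g
  map_fun' := by
    intro n f x
    choose τ hτ using fun i => FreeAlg.exists_mk V (x i)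
    obtain rfl : (fun i => FreeAlg.mk V (τ i)) = x := funext hτ
    rw [FreeAlg.funMap_mk]
    rfl
  map_rel' := fun r => isEmptyElim r

theorem _root_.PowerAlgebra.FinPow.single_funMap {A : Type w} [L.Structure A] {n : ℕ}
    (ω : L.Functions n) (a : Fin n → A) :
    FinPow.single (funMap ω a) = funMap ω fun i => FinPow.single (a i) := by
  refine FinPow.ext fun b => ?_
  simp only [mem_funMap_finPow, FinPow.mem_single, ← funext_iff]
  simp [eq_comm]

theorem isFreeInS_finPow (h : V.Mem (FinPow (V.FreeAlg X))) :
    V.IsFreeInS (FinPow (V.FreeAlg X)) fun x : X => FinPow.single (FreeAlg.of V x) := by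
  refine ⟨V.memS_finPow_iff.2 h, fun C _ _ hC g => ?_⟩
  let φ := FreeAlg.lift V hC.1 g
  refine ⟨⟨finPowSup φ, fun ω S => hC.finPowSup_funMap φ ω S, fun r => isEmptyElim r⟩,
    ⟨fun S T => finPowSup_sup φ S T, fun x => finPowSup_single φ _⟩, ?_⟩
  rintro ψ ⟨hψ, hψg⟩
  ext S
  change ψ S = finPowSup φ S
  -- Uniqueness: joins reduce to singletons, and `FinPow.single` is compatible with the operations,
  -- so induction on terms reduces to generators.
  induction S using FinPow.induction_sup with
  | sup S T hS hT => rw [hψ, hS, hT, finPowSup_sup]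
  | single a =>
    rw [finPowSup_single]
    obtain ⟨t, rfl⟩ := FreeAlg.exists_mk V a
    induction t with
    | var x => exact hψg x
    | func f ts ih =>
      rw [← FreeAlg.funMap_mk, FinPow.single_funMap, ψ.map_fun, φ.map_fun]
      exact congrArg _ (funext ih)

end Universal

end Variety

end PowerAlgebra

theorem theorem4p6 {L : FirstOrder.Language.{u, u'}} [L.IsAlgebraic]
    (V : PowerAlgebra.Variety.{u, u', max u v} L) :
    (V.IsLinear ↔ V.ClosedUnderPower) ∧
    (V.IsLinear ↔ V = V.linearization) ∧
    (∀ (X : Type v) [Infinite X],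
      (V.IsLinear ↔ V.Mem (PowerAlgebra.FinPow (V.FreeAlg X))) ∧
      (V.IsFreeInS (PowerAlgebra.FinPow (V.FreeAlg X))
          (fun x : X => PowerAlgebra.FinPow.single (PowerAlgebra.Variety.FreeAlg.of V x)) ↔
        V = V.linearization)) ∧
    (∀ X : Type v, V.IsLinear →
      V.Mem (PowerAlgebra.FinPow (V.FreeAlg X)) ∧
      V.IsFreeInS (PowerAlgebra.FinPow (V.FreeAlg X))
        (fun x : X => PowerAlgebra.FinPow.single (PowerAlgebra.Variety.FreeAlg.of V x))) := by

  have closed : V.IsLinear → ∀ X : Type v, V.Mem (PowerAlgebra.FinPow (V.FreeAlg X)) :=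
    fun h X => h.closedUnderPower _ V.mem_freeAlg
  refine ⟨⟨fun h => h.closedUnderPower, fun h => ?_⟩, V.isLinear_iff_eq_linearization,
    fun X _ => ⟨⟨fun h => closed h X, V.isLinear_of_mem_finPow_freeAlg⟩, ?_⟩,
    fun X h => ⟨closed h X, V.isFreeInS_finPow (closed h X)⟩⟩
  -- Any infinite set in the universe of `X` serves here.
  · exact V.isLinear_of_mem_finPow_freeAlg (X := ULift.{v} ℕ) (h _ V.mem_freeAlg)
  · rw [← V.isLinear_iff_eq_linearization]
    exact ⟨fun h => V.isLinear_of_mem_finPow_freeAlg h.1.1,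
      fun h => V.isFreeInS_finPow (closed h X)⟩
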